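/- Fix $\gamma>0$. For a random variable $X$ on $\mathbb{R}$ let $Y_\gamma=\sqrt{\gamma}\,X+Z$, where $Z\sim\mathcal N(0,1)$, and for $t\ge 0$ define $$F_I(t,\gamma)=\sup\{I(W;Y_\gamma)\;:\; I(W;X)\le t,\ W\to X\to Y_\gamma,\ \mathbb{E}[X^2]\le 1\},$$ where the supremum is over all joint distributions $P_{W,X}$ with $W$ taking values in an arbitrary measurable space, $Z$ is independent of $(W,X)$ (so that $W\to X\to Y_\gamma$ is a Markov chain), and $I$ denotes mutual information in nats (all logarithms are natural). Let $Q(x)=\int_x^\infty \frac{1}{\sqrt{2\pi}}e^{-s^2/2}\,ds$ and let $h_b(x)=x\log\frac1x+(1-x)\log\frac1{1-x}$ be the binary entropy function (with $h_b(0)=0$). Then for every $t\ge 0$ the value $F_I(t,\gamma)$ is finite, and the gap $g_d(t,\gamma)=t-F_I(t,\gamma)$ satisfies $$g_d(t,\gamma)\;\ge\;\max_{x\in[0,1/2]}\,2Q\!\left(\sqrt{\gamma/x}\right)\left(t-h_b(x)-\frac{x}{2}\log\!\left(1+\frac{\gamma}{x}\right)\right),$$ where the expression being maximized is read as $0$ at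 $x=0$ (as $Q(+\infty)=0$), and the maximum is attained. In particular, $F_I(t,\gamma)<t$ for every $t>0$. -/

import Mathlib

open MeasureTheory ProbabilityTheory
open scoped ENNReal

universe u

namespace GaussianSDPI

/-- The mutual information `I(W;X) = D(P_{WX} ‖ P_W × P_X)`, in nats and with values in `[0, ∞]`,
of a pair `(W, X)` with joint law `ρ`. -/
noncomputable def mutualInfo {α β : Type*} [MeasurableSpace α] [MeasurableSpace β]
    (ρ : Measure (α × β)) : ℝ≥0∞ :=
  InformationTheory.klDiv ρ (ρ.fst.prod ρ.snd)

/-- The joint law of `(W, Y_γ)`, where `(W, X)` has law `ρ` and `Y_γ = √γ X + Z` with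
`Z ∼ N(0,1)` independent of `(W, X)`. -/
noncomputable def awgnOutput {α : Type*} [MeasurableSpace α] (γ : ℝ) (ρ : Measure (α × ℝ)) :
    Measure (α × ℝ) :=
  (ρ.prod (gaussianReal 0 1)).map (fun q => (q.1.1, √γ * q.1.2 + q.2))

/-- The strong data processing function
`F_I(t, γ) = sup {I(W;Y_γ) : I(W;X) ≤ t, W → X → Y_γ, E[X²] ≤ 1}`. The supremum is over all joint
laws `ρ` of `(W, X)`, with `W` in an arbitrary measurable space. -/
noncomputable def FI (t γ : ℝ) : ℝ≥0∞ :=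
  sSup {i : ℝ≥0∞ | ∃ (α : Type u) (_ : MeasurableSpace α) (ρ : Measure (α × ℝ)),
    IsProbabilityMeasure ρ ∧
    (∫⁻ p, ENNReal.ofReal (p.2 ^ 2) ∂ρ) ≤ 1 ∧
    mutualInfo ρ ≤ ENNReal.ofReal t ∧
    i = mutualInfo (awgnOutput γ ρ)}

/-- The gap `g_d(t, γ) = t - F_I(t, γ)` to the diagonal (meaningful when `F_I(t, γ)` is finite). -/
noncomputable def gapDiag (t γ : ℝ) : ℝ := t - (FI.{u} t γ).toReal

/-- The Gaussian complementary distribution function. -/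
noncomputable def gaussianQ (x : ℝ) : ℝ :=
  ∫ s in Set.Ioi x, 1 / √(2 * Real.pi) * Real.exp (-s ^ 2 / 2)

/-- The function `x ↦ 2 Q(√(γ/x)) (t - h_b(x) - (x/2) log(1 + γ/x))`, with value `0` at `x = 0`
(because `Q(+∞) = 0`). -/
noncomputable def diagObjective (t γ x : ℝ) : ℝ :=
  if x = 0 then 0 else
    2 * gaussianQ (√(γ / x)) * (t - Real.binEntropy x - x / 2 * Real.log (1 + γ / x))

end GaussianSDPI

/-! Fix q in (0, 1/2] and put a = √(γ/q). Whenever |√γ x| ≤ a, the density of N(√γ x, 1) lies above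
φ(|y| + a), where φ is the standard normal density, and this common lower bound has mass 2Q(a). So
the Gaussian channel is a mixture (`awgnKernel_eq_mixture`): with weight 2Q(a) an erasure channel E,
which sends all these inputs to one fixed law and leaves larger inputs to the Gaussian channel, and
with weight 1 - 2Q(a) a residual channel. Joint convexity of divergence, with data processing for
the residual part, gives I(W;Y) ≤ 2Q(a) I(W;E) + (1 - 2Q(a)) t.

The erasure term has a bound free of t. By `klDiv_prod_snd_le`, I(W;E) is at most the mean
divergence of E from any reference law R. Take R to be the erased law with weight 1 - q plus N(0, 1
+ γ/q) with weight q. The divergence at input x is then at most an affine function of x²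
(`klDiv_erasureKernel_le`), so E[X²] ≤ 1 yields I(W;E) ≤ h_b(q) + (q/2) log(1 + γ/q) without
estimating any tail probability. Rearranging gives the bound on the gap. The objective is continuous
on the compact interval, and it is positive for small q when t > 0 because the erasure rate tends to
0. -/

namespace InformationTheory

open Real

/-! ### Divergence of kernels and convexity -/

section Kernel

variable {𝓧 𝓨 : Type*} {m𝓧 : MeasurableSpace 𝓧} {m𝓨 : MeasurableSpace 𝓨}

/-- The conditional Kullback-Leibler divergence as an average of divergences. -/
theorem klDiv_compProd_right_eq_lintegral [MeasurableSpace.CountableOrCountablyGenerated 𝓧 𝓨]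
    (μ : Measure 𝓧) [IsFiniteMeasure μ] (κ η : Kernel 𝓧 𝓨) [IsFiniteKernel κ] [IsFiniteKernel η]
    (h : ∀ x, κ x ≪ η x) :
    klDiv (μ ⊗ₘ κ) (μ ⊗ₘ η) = ∫⁻ x, klDiv (κ x) (η x) ∂μ := by
  have hm := Kernel.measurable_rnDeriv κ η
  have hκ : η.withDensity (κ.rnDeriv η) = κ := by
    ext1 x
    exact Kernel.withDensity_rnDeriv_eq (h x)
  have hs : IsSFiniteKernel (η.withDensity (κ.rnDeriv η)) := by rw [hκ]; infer_instance
  have hμ : μ ⊗ₘ κ = (μ ⊗ₘ η).withDensity (fun p ↦ κ.rnDeriv η p.1 p.2) := by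
    conv_lhs => rw [← hκ]
    exact Measure.compProd_withDensity hm
  have hm' : Measurable (fun p : 𝓧 × 𝓨 ↦ κ.rnDeriv η p.1 p.2) := hm
  have hd : (μ ⊗ₘ κ).rnDeriv (μ ⊗ₘ η) =ᵐ[μ ⊗ₘ η] fun p ↦ κ.rnDeriv η p.1 p.2 := by
    rw [hμ]
    exact Measure.rnDeriv_withDensity _ hm'
  rw [klDiv_eq_lintegral_klFun_of_ac (hμ ▸ withDensity_absolutelyContinuous _ _),
    lintegral_congr_ae (hd.mono fun p hp ↦ by
      show _ = (fun p ↦ ENNReal.ofReal (klFun (κ.rnDeriv η p.1 p.2).toReal)) p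
      simp only [hp]),
    Measure.lintegral_compProd (by fun_prop)]
  refine lintegral_congr fun x ↦ ?_
  rw [klDiv_eq_lintegral_klFun_of_ac (h x)]
  refine lintegral_congr_ae ?_
  filter_upwards [Kernel.rnDeriv_eq_rnDeriv_measure (κ := κ) (η := η) (a := x)] with y hy
  rw [hy]

/-- Convexity of the Kullback-Leibler divergence along a mixture. -/
theorem klDiv_comp_left_le_lintegral [MeasurableSpace.CountableOrCountablyGenerated 𝓧 𝓨]
    (μ : Measure 𝓧) [IsFiniteMeasure μ] (κ η : Kernel 𝓧 𝓨) [IsFiniteKernel κ] [IsFiniteKernel η]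
    (h : ∀ x, κ x ≪ η x) :
    klDiv (κ ∘ₘ μ) (η ∘ₘ μ) ≤ ∫⁻ x, klDiv (κ x) (η x) ∂μ := by
  rw [← klDiv_compProd_right_eq_lintegral μ κ η h, ← Measure.snd_compProd, ← Measure.snd_compProd]
  exact klDiv_map_le _ _ measurable_snd

end Kernel

/-! ### Divergence of two-component mixtures -/

section Mixture

variable {Ω : Type*} {mΩ : MeasurableSpace Ω}

/-- The kernel from `Bool` with the two given values. -/
noncomputable def boolKernel (μ₁ μ₂ : Measure Ω) : Kernel Bool Ω :=
  Kernel.ofFunOfCountable (fun b ↦ if b then μ₁ else μ₂)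

instance (μ₁ μ₂ : Measure Ω) [IsProbabilityMeasure μ₁] [IsProbabilityMeasure μ₂] :
    IsMarkovKernel (boolKernel μ₁ μ₂) :=
  ⟨fun b ↦ by cases b <;> simpa [boolKernel, Kernel.ofFunOfCountable]⟩

/-- The measure on `Bool` with the two given masses. -/
noncomputable def boolMeasure (a b : ℝ≥0∞) : Measure Bool :=
  a • Measure.dirac true + b • Measure.dirac false

lemma isProbabilityMeasure_boolMeasure {a b : ℝ≥0∞} (hab : a + b = 1) :
    IsProbabilityMeasure (boolMeasure a b) := ⟨by simp [boolMeasure, hab]⟩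

lemma boolKernel_comp_boolMeasure (μ₁ μ₂ : Measure Ω) (a b : ℝ≥0∞) :
    boolKernel μ₁ μ₂ ∘ₘ boolMeasure a b = a • μ₁ + b • μ₂ := by
  rw [boolMeasure, Measure.comp_add, Measure.comp_smul, Measure.comp_smul,
    Measure.dirac_bind (Kernel.measurable _), Measure.dirac_bind (Kernel.measurable _)]
  simp [boolKernel, Kernel.ofFunOfCountable]

/-- Joint convexity of the Kullback-Leibler divergence. -/
theorem klDiv_add_le (μ₁ μ₂ ν₁ ν₂ : Measure Ω) [IsProbabilityMeasure μ₁] [IsProbabilityMeasure μ₂]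
    [IsProbabilityMeasure ν₁] [IsProbabilityMeasure ν₂] {a b : ℝ≥0∞} (ha : a ≠ 0) (hb : b ≠ 0)
    (hab : a + b = 1) :
    klDiv (a • μ₁ + b • μ₂) (a • ν₁ + b • ν₂) ≤ a * klDiv μ₁ ν₁ + b * klDiv μ₂ ν₂ := by
  by_cases h₁ : μ₁ ≪ ν₁
  swap; · simp [klDiv_of_not_ac h₁, ENNReal.mul_top ha]
  by_cases h₂ : μ₂ ≪ ν₂
  swap; · simp [klDiv_of_not_ac h₂, ENNReal.mul_top hb]
  have := isProbabilityMeasure_boolMeasure hab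
  rw [← boolKernel_comp_boolMeasure, ← boolKernel_comp_boolMeasure]
  refine (klDiv_comp_left_le_lintegral _ _ _ ?_).trans_eq ?_
  · intro i
    cases i <;> simpa [boolKernel, Kernel.ofFunOfCountable]
  · rw [boolMeasure, lintegral_add_measure, lintegral_smul_measure, lintegral_smul_measure]
    simp [boolKernel, Kernel.ofFunOfCountable]

lemma klDiv_dirac_true {a b : ℝ≥0∞} (ha : a ≠ 0) (hab : a + b = 1) :
    klDiv (Measure.dirac true) (boolMeasure a b) = ENNReal.ofReal (-log a.toReal) := by
  have := isProbabilityMeasure_boolMeasure hab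
  have hac : Measure.dirac true ≪ boolMeasure a b := by
    refine Measure.AbsolutelyContinuous.mk fun s hs h ↦ ?_
    by_contra h'
    have ht : true ∈ s := by
      by_contra ht
      simp [ht] at h'
    simp [boolMeasure, ht, ha] at h
  have ha' : a ≠ ⊤ := fun h ↦ by simp [h] at hab
  have h1 := Measure.withDensity_rnDeriv_eq _ _ hac
  have h2 : (Measure.dirac true).rnDeriv (boolMeasure a b) true * a = 1 := by
    have := congrArg (fun μ ↦ μ {true}) h1
    simpa [withDensity_apply, boolMeasure, mul_comm] using this
  rw [klDiv_of_ac_of_integrable hac (integrable_dirac (by simp [enorm_lt_top]))]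
  simp only [integral_dirac, probReal_univ, add_sub_cancel_right]
  rw [llr, ENNReal.eq_inv_of_mul_eq_one_left h2, ENNReal.toReal_inv, log_inv]

/-- Comparison with a mixture having the given reference measure as a component. -/
theorem klDiv_le_klDiv_add_neg_log (μ ν₁ ν₂ : Measure Ω) [IsProbabilityMeasure μ]
    [IsProbabilityMeasure ν₁] [IsProbabilityMeasure ν₂] {a b : ℝ≥0∞} (ha : a ≠ 0)
    (hab : a + b = 1) :
    klDiv μ (a • ν₁ + b • ν₂) ≤ ENNReal.ofReal (-log a.toReal) + klDiv μ ν₁ := by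
  by_cases h₁ : μ ≪ ν₁
  swap; · simp [klDiv_of_not_ac h₁]
  have := isProbabilityMeasure_boolMeasure hab
  -- Keep the component label as a first coordinate: the chain rule splits the joint divergence into
  -- the label's cost -log a and the divergence inside the selected component. Forgetting the label
  -- can only decrease it.
  have h := klDiv_compProd_eq_add (Measure.dirac true) (boolMeasure a b)
    (boolKernel μ ν₂) (boolKernel ν₁ ν₂)
  rw [klDiv_dirac_true ha hab, klDiv_compProd_right_eq_lintegral] at h
  · rw [lintegral_dirac] at h
    have h3 := klDiv_map_le (Measure.dirac true ⊗ₘ boolKernel μ ν₂)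
      (boolMeasure a b ⊗ₘ boolKernel ν₁ ν₂) measurable_snd
    rw [h] at h3
    rw [← boolKernel_comp_boolMeasure]
    refine le_trans (le_of_eq ?_) (h3.trans_eq ?_)
    · rw [← Measure.snd_compProd, Measure.snd]
      congr 1
      rw [← Measure.snd, Measure.snd_compProd, Measure.dirac_bind (Kernel.measurable _)]
      simp [boolKernel, Kernel.ofFunOfCountable]
    · simp [boolKernel, Kernel.ofFunOfCountable]
  · intro i
    cases i
    · simpa [boolKernel, Kernel.ofFunOfCountable] using Measure.AbsolutelyContinuous.refl _
    · simpa [boolKernel, Kernel.ofFunOfCountable]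

end Mixture

/-! ### The product of marginals as the best product reference -/

section Golden

variable {α β : Type*} {mα : MeasurableSpace α} {mβ : MeasurableSpace β}

/-- Among all product measures with the same first factor, the product of the marginals is closest
to a given joint law. -/
theorem klDiv_prod_snd_le (ρ : Measure (α × β)) [IsProbabilityMeasure ρ] (μ : Measure α)
    [IsProbabilityMeasure μ] (R : Measure β) [IsProbabilityMeasure R] :
    klDiv ρ (μ.prod ρ.snd) ≤ klDiv ρ (μ.prod R) := by
  by_cases htop : klDiv ρ (μ.prod R) = ⊤
  · simp [htop]
  obtain ⟨hac, hint⟩ := klDiv_ne_top_iff.1 htop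
  have hsnd : klDiv ρ.snd R ≤ klDiv ρ (μ.prod R) := by
    simpa [Measure.snd] using klDiv_map_le ρ (μ.prod R) measurable_snd
  obtain ⟨hacν, hintν⟩ := klDiv_ne_top_iff.1 (ne_top_of_le_ne_top htop hsnd)
  set ν := ρ.snd with hν
  have h1 : μ.prod ν = (μ.prod R).withDensity (fun p ↦ ν.rnDeriv R p.2) := by
    conv_lhs => rw [← Measure.withDensity_rnDeriv_eq _ _ hacν]
    rw [prod_withDensity_right]
    fun_prop
  have hd : (μ.prod ν).rnDeriv (μ.prod R) =ᵐ[μ.prod R] fun p ↦ ν.rnDeriv R p.2 := by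
    conv_lhs => rw [h1]
    exact Measure.rnDeriv_withDensity _ (by fun_prop)
  -- The density of ν with respect to R may vanish, but not on a set charged by ρ, whose second
  -- marginal is ν. This lets ρ ≪ μ × R descend to ρ ≪ μ × ν.
  have hpos : ∀ᵐ p ∂ρ, 0 < ν.rnDeriv R p.2 :=
    ae_of_ae_map measurable_snd.aemeasurable (Measure.rnDeriv_pos hacν)
  have hac' : ρ ≪ μ.prod ν := by
    refine Measure.AbsolutelyContinuous.mk fun s hs h ↦ ?_
    rw [h1, withDensity_apply _ hs, setLIntegral_eq_zero_iff hs (by fun_prop)] at h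
    have := hac.ae_le h
    rw [← compl_compl s, ← mem_ae_iff]
    filter_upwards [this, hpos] with p h1 h2 hs
    exact h2.ne' (h1 hs)
  have hllr : (fun p ↦ llr ρ (μ.prod R) p - llr ν R p.2) =ᵐ[ρ] llr ρ (μ.prod ν) := by
    filter_upwards [hac.ae_le (Measure.rnDeriv_mul_rnDeriv (κ := μ.prod R) hac'), hac.ae_le hd,
      hpos, Measure.rnDeriv_pos hac', hac'.ae_le (Measure.rnDeriv_ne_top ρ (μ.prod ν)),
      ae_of_ae_map measurable_snd.aemeasurable (hacν.ae_le (Measure.rnDeriv_ne_top ν R))]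
      with p h1 h2 h3 h4 h5 h6
    simp only [llr, ← h1, Pi.mul_apply, h2, ENNReal.toReal_mul]
    rw [log_mul (ENNReal.toReal_pos h4.ne' h5).ne' (ENNReal.toReal_pos h3.ne' h6).ne']
    ring
  have hintν' : Integrable (fun p ↦ llr ν R p.2) ρ := hintν.comp_measurable measurable_snd
  have hint' : Integrable (llr ρ (μ.prod ν)) ρ := (hint.sub hintν').congr hllr
  rw [klDiv_of_ac_of_integrable hac hint, klDiv_of_ac_of_integrable hac' hint']
  refine ENNReal.ofReal_le_ofReal ?_
  -- The two sides differ by D(ν ‖ R), which is nonnegative.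
  have h0 := integral_llr_add_sub_measure_univ_nonneg hacν hintν
  have h1 : ∫ p, llr ν R p.2 ∂ρ = ∫ y, llr ν R y ∂ν := by
    rw [hν, Measure.snd, integral_map measurable_snd.aemeasurable]
    exact (measurable_llr _ _).aestronglyMeasurable
  have hν1 : IsProbabilityMeasure ν := by rw [hν]; infer_instance
  rw [← integral_congr_ae hllr, integral_sub hint hintν', h1]
  simp only [probReal_univ] at h0 ⊢
  linarith

end Golden

end InformationTheory

namespace GaussianSDPI

open InformationTheory

/-! ### Mutual information through a channel -/

section Channel

variable {α β γ : Type*} [MeasurableSpace α] [MeasurableSpace β] [MeasurableSpace γ]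

/-- The joint law of `(W, Y)`, where `(W, X)` has law `ρ` and `Y` is the output of the channel `K`
with input `X`. -/
noncomputable def channelOutput (K : Kernel β γ) (ρ : Measure (α × β)) : Measure (α × γ) :=
  (Kernel.id ∥ₖ K) ∘ₘ ρ

lemma channelOutput_apply (K : Kernel β γ) [IsSFiniteKernel K] (ρ : Measure (α × β))
    {s : Set (α × γ)} (hs : MeasurableSet s) :
    channelOutput K ρ s = ∫⁻ p, K p.2 (Prod.mk p.1 ⁻¹' s) ∂ρ := by
  rw [channelOutput, Measure.bind_apply hs (Kernel.aemeasurable _)]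
  refine lintegral_congr fun p ↦ ?_
  rw [Kernel.parallelComp_apply' hs, Kernel.id_apply,
    lintegral_dirac' _ (measurable_measure_prodMk_left hs)]

instance (K : Kernel β γ) [IsMarkovKernel K] (ρ : Measure (α × β)) [IsProbabilityMeasure ρ] :
    IsProbabilityMeasure (channelOutput K ρ) := by
  unfold channelOutput; infer_instance

lemma fst_channelOutput (K : Kernel β γ) [IsMarkovKernel K] (ρ : Measure (α × β)) :
    (channelOutput K ρ).fst = ρ.fst := by
  ext s hs
  rw [Measure.fst_apply hs, channelOutput_apply _ _ (measurable_fst hs), Measure.fst_apply hs,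
    ← lintegral_indicator_one (measurable_fst hs)]
  refine lintegral_congr fun p ↦ ?_
  by_cases hp : p.1 ∈ s <;> simp [Set.indicator, Set.preimage, hp]

lemma snd_channelOutput (K : Kernel β γ) [IsSFiniteKernel K] (ρ : Measure (α × β)) :
    (channelOutput K ρ).snd = K ∘ₘ ρ.snd := by
  ext s hs
  rw [Measure.snd_apply hs, channelOutput_apply _ _ (measurable_snd hs),
    Measure.bind_apply hs (Kernel.aemeasurable _), Measure.snd,
    lintegral_map (Kernel.measurable_coe _ hs) measurable_snd]
  rfl

lemma channelOutput_prod (K : Kernel β γ) [IsSFiniteKernel K] (μ : Measure α) (ν : Measure β)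
    [SFinite ν] : channelOutput K (μ.prod ν) = μ.prod (K ∘ₘ ν) :=
  Measure.prod_comp_right.symm

lemma channelOutput_const (R : Measure γ) [SFinite R] (ρ : Measure (α × β)) :
    channelOutput (Kernel.const β R) ρ = ρ.fst.prod R := by
  ext s hs
  rw [channelOutput_apply _ _ hs, Measure.prod_apply hs, Measure.fst,
    lintegral_map (measurable_measure_prodMk_left hs) measurable_fst]
  rfl

lemma channelOutput_eq_map_compProd (K : Kernel β γ) [IsSFiniteKernel K] (ρ : Measure (α × β))
    [SFinite ρ] :
    channelOutput K ρ = (ρ ⊗ₘ Kernel.prodMkLeft α K).map (fun q ↦ (q.1.1, q.2)) := by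
  have hf : Measurable (fun q : (α × β) × γ ↦ (q.1.1, q.2)) := by fun_prop
  ext s hs
  rw [channelOutput_apply _ _ hs, Measure.map_apply hf hs, Measure.compProd_apply (hf hs)]
  rfl

lemma channelOutput_mixture (K K₁ K₂ : Kernel β γ) [IsSFiniteKernel K] [IsSFiniteKernel K₁]
    [IsSFiniteKernel K₂] {a b : ℝ≥0∞} (hK : ∀ x, K x = a • K₁ x + b • K₂ x)
    (ρ : Measure (α × β)) :
    channelOutput K ρ = a • channelOutput K₁ ρ + b • channelOutput K₂ ρ := by
  ext s hs
  have h (K' : Kernel β γ) [IsSFiniteKernel K'] :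
      Measurable fun p : α × β ↦ K' p.2 (Prod.mk p.1 ⁻¹' s) := by
    have hm := Kernel.measurable_coe ((Kernel.id : Kernel α α) ∥ₖ K') hs
    convert hm using 2 with p
    rw [Kernel.parallelComp_apply' hs, Kernel.id_apply,
      lintegral_dirac' _ (measurable_measure_prodMk_left hs)]
  simp only [Measure.add_apply, Measure.smul_apply, smul_eq_mul, channelOutput_apply _ _ hs, hK]
  rw [lintegral_add_left ((h K₁).const_mul a), lintegral_const_mul _ (h K₁),
    lintegral_const_mul _ (h K₂)]

/-- Both arguments become images under the same channel, hence linear in `K`. Data processing and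
joint convexity then apply directly, with no conditional law of X given W, so W may live in any
measurable space. -/
lemma mutualInfo_channelOutput (K : Kernel β γ) [IsMarkovKernel K] (ρ : Measure (α × β))
    [IsProbabilityMeasure ρ] :
    mutualInfo (channelOutput K ρ) =
      klDiv (channelOutput K ρ) (channelOutput K (ρ.fst.prod ρ.snd)) := by
  rw [mutualInfo, fst_channelOutput, snd_channelOutput, channelOutput_prod]

/-- The data processing inequality for mutual information. -/
theorem mutualInfo_channelOutput_le (K : Kernel β γ) [IsMarkovKernel K] (ρ : Measure (α × β))
    [IsProbabilityMeasure ρ] : mutualInfo (channelOutput K ρ) ≤ mutualInfo ρ := by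
  rw [mutualInfo_channelOutput]
  exact klDiv_comp_right_le _ _ _

/-- Mutual information is at most the average divergence of the channel from a fixed output law. -/
theorem mutualInfo_channelOutput_le_lintegral [MeasurableSpace.CountablyGenerated γ]
    (K : Kernel β γ) [IsMarkovKernel K] (ρ : Measure (α × β)) [IsProbabilityMeasure ρ]
    (R : Measure γ) [IsProbabilityMeasure R] (hR : ∀ x, K x ≪ R) :
    mutualInfo (channelOutput K ρ) ≤ ∫⁻ p, klDiv (K p.2) R ∂ρ := by
  rw [mutualInfo, fst_channelOutput]
  refine (klDiv_prod_snd_le _ _ R).trans ?_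
  -- Compare the laws of (W, X, output) under `K` and under the constant channel `R`, then forget X.
  rw [← channelOutput_const R ρ, channelOutput_eq_map_compProd, channelOutput_eq_map_compProd]
  refine (klDiv_map_le _ _ (by fun_prop)).trans_eq ?_
  rw [klDiv_compProd_right_eq_lintegral]
  · rfl
  · exact fun p ↦ hR p.2

/-- If a channel is a mixture of two channels, then so is the bound on the mutual information. -/
theorem mutualInfo_channelOutput_le_of_mixture [MeasurableSpace.CountablyGenerated γ]
    (K K₁ K₂ : Kernel β γ) [IsMarkovKernel K] [IsMarkovKernel K₁] [IsMarkovKernel K₂]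
    {a b : ℝ≥0∞} (ha : a ≠ 0) (hb : b ≠ 0) (hab : a + b = 1)
    (hK : ∀ x, K x = a • K₁ x + b • K₂ x) (ρ : Measure (α × β)) [IsProbabilityMeasure ρ]
    (R : Measure γ) [IsProbabilityMeasure R] (hR : ∀ x, K₁ x ≪ R) :
    mutualInfo (channelOutput K ρ) ≤ a * ∫⁻ p, klDiv (K₁ p.2) R ∂ρ + b * mutualInfo ρ := by
  rw [mutualInfo_channelOutput, channelOutput_mixture K K₁ K₂ hK, channelOutput_mixture K K₁ K₂ hK]
  refine (klDiv_add_le _ _ _ _ ha hb hab).trans ?_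
  rw [← mutualInfo_channelOutput, ← mutualInfo_channelOutput]
  gcongr
  · exact mutualInfo_channelOutput_le_lintegral K₁ ρ R hR
  · exact mutualInfo_channelOutput_le K₂ ρ

end Channel

end GaussianSDPI

/-! ### Gaussian tails, densities and the erasure decomposition -/

namespace GaussianSDPI

open InformationTheory Real
open scoped NNReal

lemma gaussianPDFReal_zero_one (y : ℝ) :
    gaussianPDFReal 0 1 y = 1 / √(2 * π) * exp (-y ^ 2 / 2) := by
  simp [gaussianPDFReal]

lemma gaussianQ_eq (x : ℝ) : gaussianQ x = ∫ s in Set.Ioi x, gaussianPDFReal 0 1 s := by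
  simp only [gaussianPDFReal_zero_one, gaussianQ]

lemma gaussianQ_eq_sub (x : ℝ) :
    gaussianQ x = gaussianQ 0 - ∫ s in (0 : ℝ)..x, gaussianPDFReal 0 1 s := by
  have hint : Integrable (gaussianPDFReal 0 1) := integrable_gaussianPDFReal 0 1
  rw [gaussianQ_eq, gaussianQ_eq,
    ← intervalIntegral.integral_Ioi_sub_Ioi' hint.integrableOn hint.integrableOn]
  ring

lemma continuous_gaussianQ : Continuous gaussianQ := by
  rw [funext gaussianQ_eq_sub]
  exact continuous_const.sub (intervalIntegral.continuous_primitive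
    (fun _ _ ↦ (integrable_gaussianPDFReal 0 1).intervalIntegrable) 0)

lemma gaussianQ_pos (x : ℝ) : 0 < gaussianQ x := by
  rw [gaussianQ_eq, setIntegral_pos_iff_support_of_nonneg_ae
    (.of_forall fun y ↦ gaussianPDFReal_nonneg 0 1 y) (integrable_gaussianPDFReal 0 1).integrableOn]
  have : Function.support (gaussianPDFReal 0 1) = Set.univ := by
    ext y; simpa using (gaussianPDFReal_pos 0 1 y one_ne_zero).ne'
  simp [this]

/-- The pointwise infimum of the unit variance Gaussian densities with mean in `[-a, a]`. -/
noncomputable def infGaussianPDF (a y : ℝ) : ℝ := gaussianPDFReal 0 1 (|y| + a)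

lemma infGaussianPDF_nonneg (a y : ℝ) : 0 ≤ infGaussianPDF a y := gaussianPDFReal_nonneg _ _ _

@[fun_prop]
lemma measurable_infGaussianPDF (a : ℝ) : Measurable (infGaussianPDF a) :=
  (measurable_gaussianPDFReal 0 1).comp (by fun_prop)

lemma infGaussianPDF_le {a m : ℝ} (hm : |m| ≤ a) (y : ℝ) :
    infGaussianPDF a y ≤ gaussianPDFReal m 1 y := by
  have h : |y - m| ≤ |y| + a := (abs_sub y m).trans (by linarith)
  have h2 : (y - m) ^ 2 ≤ (|y| + a) ^ 2 := by
    rw [← sq_abs (y - m)]; gcongr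
  simp only [infGaussianPDF, gaussianPDFReal, sub_zero]
  gcongr

/-- Strictness gives 2Q(a) < 1, so that the residual channel can be normalized. -/
lemma infGaussianPDF_lt {a : ℝ} (ha : 0 < a) (y : ℝ) :
    infGaussianPDF a y < gaussianPDFReal 0 1 y := by
  have h2 : y ^ 2 < (|y| + a) ^ 2 := by
    rw [← sq_abs y]; gcongr; linarith
  simp only [infGaussianPDF, gaussianPDFReal, sub_zero]
  gcongr

lemma integrable_infGaussianPDF {a : ℝ} (ha : 0 ≤ a) : Integrable (infGaussianPDF a) :=
  (integrable_gaussianPDFReal 0 1).mono' (measurable_infGaussianPDF a).aestronglyMeasurable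
    (.of_forall fun y ↦ by
      rw [norm_of_nonneg (infGaussianPDF_nonneg a y)]
      exact infGaussianPDF_le (by simpa using ha) y)

/-- The integrand is even in y, and a shift by a turns each half into the tail Q(a). -/
lemma integral_infGaussianPDF (a : ℝ) : ∫ y, infGaussianPDF a y = 2 * gaussianQ a := by
  have h := integral_comp_abs (f := fun y ↦ gaussianPDFReal 0 1 (y + a))
  have h2 := (measurePreserving_add_right (volume : Measure ℝ) a).setIntegral_preimage_emb
    (measurableEmbedding_addRight a) (gaussianPDFReal 0 1) (Set.Ioi a)
  simp only [infGaussianPDF]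
  rw [h, gaussianQ_eq, ← h2]
  simp

lemma two_mul_gaussianQ_lt_one {a : ℝ} (ha : 0 < a) : 2 * gaussianQ a < 1 := by
  rw [← integral_infGaussianPDF, ← integral_gaussianPDFReal_eq_one 0 one_ne_zero, ← sub_pos,
    ← integral_sub (integrable_gaussianPDFReal 0 1) (integrable_infGaussianPDF ha.le),
    integral_pos_iff_support_of_nonneg (fun y ↦ (sub_pos.2 (infGaussianPDF_lt ha y)).le)
      ((integrable_gaussianPDFReal 0 1).sub (integrable_infGaussianPDF ha.le))]
  have : Function.support (fun y ↦ gaussianPDFReal 0 1 y - infGaussianPDF a y) = Set.univ := by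
    ext y; simpa using (sub_pos.2 (infGaussianPDF_lt ha y)).ne'
  simp [this]

lemma lintegral_infGaussianPDF {a : ℝ} (ha : 0 ≤ a) :
    ∫⁻ y, ENNReal.ofReal (infGaussianPDF a y) = ENNReal.ofReal (2 * gaussianQ a) := by
  rw [← integral_infGaussianPDF, ofReal_integral_eq_lintegral_ofReal (integrable_infGaussianPDF ha)
    (.of_forall (infGaussianPDF_nonneg a))]

/-- The divergence between two Gaussian laws. -/
lemma klDiv_gaussianReal (m : ℝ) {v : ℝ≥0} (hv : v ≠ 0) :
    klDiv (gaussianReal m 1) (gaussianReal 0 v) =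
      ENNReal.ofReal (1 / 2 * log v + (1 + m ^ 2) / (2 * v) - 1 / 2) := by
  have hac : gaussianReal m 1 ≪ gaussianReal 0 v :=
    (gaussianReal_absolutelyContinuous m one_ne_zero).trans
      (gaussianReal_absolutelyContinuous' 0 hv)
  have hv0 : (0 : ℝ) < v := by positivity
  have hllr : (fun y ↦ 1 / 2 * log v - (y - m) ^ 2 / 2 + y ^ 2 / (2 * v)) =ᵐ[gaussianReal m 1]
      llr (gaussianReal m 1) (gaussianReal 0 v) := by
    have hac1 := gaussianReal_absolutelyContinuous m (v := 1) one_ne_zero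
    filter_upwards [hac1.ae_le (Measure.rnDeriv_mul_rnDeriv (κ := volume) hac),
      hac1.ae_le (rnDeriv_gaussianReal m 1), hac1.ae_le (rnDeriv_gaussianReal 0 v)] with y h1 h2 h3
    rw [Pi.mul_apply, h2, h3] at h1
    have h4 := congrArg ENNReal.toReal h1
    rw [ENNReal.toReal_mul, toReal_gaussianPDF, toReal_gaussianPDF,
      ← eq_div_iff (gaussianPDFReal_pos 0 v y hv).ne'] at h4
    rw [llr, h4, log_div (gaussianPDFReal_pos m 1 y one_ne_zero).ne'
      (gaussianPDFReal_pos 0 v y hv).ne', gaussianPDFReal, gaussianPDFReal,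
      log_mul (by positivity) (by positivity), log_mul (by positivity) (by positivity), log_exp,
      log_exp, log_inv, log_inv, log_sqrt (by positivity), log_sqrt (by positivity),
      log_mul (by positivity) (by positivity), log_mul (x := 2 * π) (by positivity) (by positivity)]
    simp
    ring
  have hi1 : Integrable (fun y ↦ (y - m) ^ 2) (gaussianReal m 1) :=
    ((memLp_id_gaussianReal 2).sub (memLp_const m)).integrable_sq
  have hi2 : Integrable (fun y ↦ y ^ 2) (gaussianReal m 1) :=
    (memLp_id_gaussianReal 2).integrable_sq
  have hvar : ∫ y, (y - m) ^ 2 ∂gaussianReal m 1 = 1 := by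
    have := variance_fun_id_gaussianReal (μ := m) (v := 1)
    rw [variance_eq_integral (by fun_prop)] at this
    simpa using this
  have hsq : ∫ y, y ^ 2 ∂gaussianReal m 1 = 1 + m ^ 2 := by
    have := variance_fun_id_gaussianReal (μ := m) (v := 1)
    rw [variance_eq_sub (X := fun y ↦ y) (memLp_id_gaussianReal 2)] at this
    simp at this
    linarith
  have hi3 : Integrable (fun y ↦ 1 / 2 * log v - (y - m) ^ 2 / 2) (gaussianReal m 1) :=
    (integrable_const _).sub (hi1.div_const _)
  have hi : Integrable (fun y ↦ 1 / 2 * log v - (y - m) ^ 2 / 2 + y ^ 2 / (2 * v))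
      (gaussianReal m 1) := hi3.add (hi2.div_const _)
  rw [klDiv_of_ac_of_integrable hac (hi.congr hllr), ← integral_congr_ae hllr,
    integral_add hi3 (hi2.div_const _),
    integral_sub (integrable_const _) (hi1.div_const _), integral_div, integral_div, hvar, hsq]
  simp
  ring_nf

/-- The additive white Gaussian noise channel `x ↦ N(√γ x, 1)`. -/
noncomputable def awgnKernel (γ : ℝ) : Kernel ℝ ℝ :=
  ⟨fun x ↦ gaussianReal (√γ * x) 1, measurable_gaussianReal.comp
    (f := fun x ↦ (√γ * x, (1 : ℝ≥0))) (by fun_prop)⟩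

lemma awgnKernel_apply (γ x : ℝ) : awgnKernel γ x = gaussianReal (√γ * x) 1 := rfl

instance (γ : ℝ) : IsMarkovKernel (awgnKernel γ) :=
  ⟨fun x ↦ by rw [awgnKernel_apply]; infer_instance⟩

lemma awgnOutput_eq_channelOutput {α : Type*} [MeasurableSpace α] (γ : ℝ) (ρ : Measure (α × ℝ))
    [SFinite ρ] : awgnOutput γ ρ = channelOutput (awgnKernel γ) ρ := by
  have hf : Measurable (fun q : (α × ℝ) × ℝ ↦ (q.1.1, √γ * q.1.2 + q.2)) := by fun_prop
  ext s hs
  rw [awgnOutput, Measure.map_apply hf hs, Measure.prod_apply (hf hs), channelOutput_apply _ _ hs]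
  refine lintegral_congr fun p ↦ ?_
  have h := gaussianReal_map_const_add (μ := 0) (v := 1) (√γ * p.2)
  rw [zero_add] at h
  rw [awgnKernel_apply, ← h,
    Measure.map_apply (by fun_prop) (measurable_prodMk_left hs)]
  rfl

section Decomposition

variable (γ a : ℝ)

/-- The law with density proportional to `infGaussianPDF a`. -/
noncomputable def infGaussian : Measure ℝ :=
  (ENNReal.ofReal (2 * gaussianQ a))⁻¹ •
    (volume : Measure ℝ).withDensity (fun y ↦ ENNReal.ofReal (infGaussianPDF a y))

lemma ofReal_two_mul_gaussianQ_ne_zero : ENNReal.ofReal (2 * gaussianQ a) ≠ 0 := by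
  simpa using gaussianQ_pos a

lemma isProbabilityMeasure_infGaussian (ha : 0 ≤ a) : IsProbabilityMeasure (infGaussian a) := ⟨by
  rw [infGaussian, Measure.smul_apply, withDensity_apply _ .univ, Measure.restrict_univ,
    lintegral_infGaussianPDF ha, smul_eq_mul,
    ENNReal.inv_mul_cancel (ofReal_two_mul_gaussianQ_ne_zero a) ENNReal.ofReal_ne_top]⟩

lemma measurableSet_abs_le : MeasurableSet {x : ℝ | |√γ * x| ≤ a} :=
  measurableSet_le (by fun_prop) measurable_const

open Classical in
/-- The channel that erases the inputs `x` with `|√γ x| ≤ a`. -/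
noncomputable def erasureKernel : Kernel ℝ ℝ :=
  Kernel.piecewise (measurableSet_abs_le γ a) (Kernel.const ℝ (infGaussian a)) (awgnKernel γ)

lemma erasureKernel_of_le {x : ℝ} (hx : |√γ * x| ≤ a) :
    erasureKernel γ a x = infGaussian a := by
  rw [erasureKernel, Kernel.piecewise_apply, if_pos (by exact hx), Kernel.const_apply]

lemma erasureKernel_of_lt {x : ℝ} (hx : a < |√γ * x|) :
    erasureKernel γ a x = awgnKernel γ x := by
  rw [erasureKernel, Kernel.piecewise_apply, if_neg (by exact hx.not_ge)]

lemma isMarkovKernel_erasureKernel (ha : 0 ≤ a) : IsMarkovKernel (erasureKernel γ a) := by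
  have := isProbabilityMeasure_infGaussian a ha
  unfold erasureKernel
  infer_instance

open Classical in
/-- The density of the channel that remains when the erasures are removed. -/
noncomputable def residualDensity (x y : ℝ) : ℝ≥0∞ :=
  if |√γ * x| ≤ a then
    ENNReal.ofReal ((gaussianPDFReal (√γ * x) 1 y - infGaussianPDF a y) / (1 - 2 * gaussianQ a))
  else gaussianPDF (√γ * x) 1 y

lemma measurable_residualDensity : Measurable (Function.uncurry (residualDensity γ a)) := by
  have h : Measurable fun p : ℝ × ℝ ↦ gaussianPDFReal (√γ * p.1) 1 p.2 :=
    measurable_uncurry_gaussianPDFReal.comp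
      (f := fun p : ℝ × ℝ ↦ (√γ * p.1, (1 : ℝ≥0), p.2)) (by fun_prop)
  refine Measurable.ite (measurable_fst (measurableSet_abs_le γ a)) ?_ h.ennreal_ofReal
  exact ((h.sub ((measurable_infGaussianPDF a).comp measurable_snd)).div_const _).ennreal_ofReal

/-- The channel that remains when the erasures are removed. -/
noncomputable def residualKernel : Kernel ℝ ℝ :=
  Kernel.withDensity (Kernel.const ℝ volume) (residualDensity γ a)

lemma residualKernel_apply (x : ℝ) :
    residualKernel γ a x = volume.withDensity (residualDensity γ a x) := by
  rw [residualKernel, Kernel.withDensity_apply _ (measurable_residualDensity γ a),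
    Kernel.const_apply]

lemma isMarkovKernel_residualKernel (ha : 0 < a) : IsMarkovKernel (residualKernel γ a) := by
  refine ⟨fun x ↦ ⟨?_⟩⟩
  rw [residualKernel_apply, withDensity_apply _ .univ, Measure.restrict_univ]
  by_cases hx : |√γ * x| ≤ a
  · have h1 := integrable_gaussianPDFReal (√γ * x) 1
    have h2 := integrable_infGaussianPDF ha.le
    have h3 : 0 < 1 - 2 * gaussianQ a := sub_pos.2 (two_mul_gaussianQ_lt_one ha)
    simp only [residualDensity, hx, if_true]
    have h4 : Integrable fun y ↦ gaussianPDFReal (√γ * x) 1 y - infGaussianPDF a y := h1.sub h2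
    rw [← ofReal_integral_eq_lintegral_ofReal (h4.div_const _)
      (.of_forall fun y ↦ div_nonneg (sub_nonneg.2 (infGaussianPDF_le hx y)) h3.le),
      integral_div, integral_sub h1 h2, integral_infGaussianPDF,
      integral_gaussianPDFReal_eq_one _ one_ne_zero, div_self h3.ne', ENNReal.ofReal_one]
  · simp only [residualDensity, hx, if_false]
    exact lintegral_gaussianPDF_eq_one _ one_ne_zero

lemma awgnKernel_eq_mixture (ha : 0 < a) (x : ℝ) :
    awgnKernel γ x = ENNReal.ofReal (2 * gaussianQ a) • erasureKernel γ a x +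
      ENNReal.ofReal (1 - 2 * gaussianQ a) • residualKernel γ a x := by
  have h0 : 0 < 2 * gaussianQ a := mul_pos two_pos (gaussianQ_pos a)
  have h3 : 0 < 1 - 2 * gaussianQ a := sub_pos.2 (two_mul_gaussianQ_lt_one ha)
  rw [residualKernel_apply]
  by_cases hx : |√γ * x| ≤ a
  · rw [erasureKernel_of_le _ _ hx, infGaussian, smul_smul, ENNReal.mul_inv_cancel
      (ofReal_two_mul_gaussianQ_ne_zero a) ENNReal.ofReal_ne_top, one_smul,
      ← withDensity_smul _ (measurable_residualDensity γ a).of_uncurry_left,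
      ← withDensity_add_left (by fun_prop), awgnKernel_apply,
      gaussianReal_of_var_ne_zero _ one_ne_zero]
    congr 1
    ext y
    simp only [residualDensity, hx, if_true, Pi.add_apply, Pi.smul_apply, smul_eq_mul]
    rw [← ENNReal.ofReal_mul h3.le, mul_div_cancel₀ _ h3.ne',
      ← ENNReal.ofReal_add (infGaussianPDF_nonneg a y) (sub_nonneg.2 (infGaussianPDF_le hx y)),
      add_sub_cancel, gaussianPDF]
  · have h4 : volume.withDensity (residualDensity γ a x) = awgnKernel γ x := by
      rw [awgnKernel_apply, gaussianReal_of_var_ne_zero _ one_ne_zero]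
      congr 1
      ext y
      rw [residualDensity, if_neg hx]
    rw [erasureKernel_of_lt _ _ (not_le.1 hx), h4, ← add_smul, ← ENNReal.ofReal_add h0.le h3.le]
    simp

end Decomposition

end GaussianSDPI

/-! ### The erasure rate and the bound on the gap -/

namespace GaussianSDPI

open InformationTheory Real
open scoped NNReal

/-- This is 1 - 1/v ≤ log v at v = 1 + γ/q, multiplied by q. It lets the quadratic term of the
Gaussian divergence be absorbed into the logarithm. -/
lemma one_sub_inv_le_log_mul {q γ : ℝ} (hq : 0 < q) (hγ : 0 < γ) :
    γ / (1 + γ / q) ≤ q * log (1 + γ / q) := by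
  have h := one_sub_inv_le_log_of_pos (x := 1 + γ / q) (by positivity)
  calc γ / (1 + γ / q) = q * (1 - (1 + γ / q)⁻¹) := by field_simp; ring
    _ ≤ _ := by gcongr

/-- The divergence of the erasure channel from a suitable mixture is at most a quadratic function
of the input. -/
lemma klDiv_erasureKernel_le {γ q : ℝ} (hγ : 0 < γ) (hq : 0 < q) (hq2 : q ≤ 1 / 2) (x : ℝ) :
    klDiv (erasureKernel γ (√(γ / q)) x)
      (ENNReal.ofReal (1 - q) • infGaussian (√(γ / q)) +
        ENNReal.ofReal q • gaussianReal 0 (1 + γ / q).toNNReal) ≤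
      ENNReal.ofReal (-log (1 - q)) +
        ENNReal.ofReal (q * (-log q + log (1 - q) + 1 / 2 * log (1 + γ / q))) *
          ENNReal.ofReal (x ^ 2) := by
  have := isProbabilityMeasure_infGaussian (√(γ / q)) (sqrt_nonneg _)
  have hq1 : 0 < 1 - q := by linarith
  have hsum : ENNReal.ofReal (1 - q) + ENNReal.ofReal q = 1 := by
    rw [← ENNReal.ofReal_add hq1.le hq.le]; simp
  have hv : 0 < 1 + γ / q := by positivity
  have hlog : log q ≤ log (1 - q) := log_le_log hq (by linarith)
  have hlog0 : log (1 - q) ≤ 0 := log_nonpos hq1.le (by linarith)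
  have hlogv := one_sub_inv_le_log_mul hq hγ
  have hlogv0 : 0 ≤ log (1 + γ / q) := log_nonneg (by linarith [div_pos hγ hq])
  rcases le_or_gt |√γ * x| √(γ / q) with hx | hx
  · rw [erasureKernel_of_le _ _ hx]
    refine (klDiv_le_klDiv_add_neg_log _ _ _ (by simpa using hq1) hsum).trans ?_
    rw [klDiv_self, add_zero, ENNReal.toReal_ofReal hq1.le]
    exact le_self_add
  · rw [erasureKernel_of_lt _ _ hx, awgnKernel_apply, add_comm (ENNReal.ofReal (1 - q) • _)]
    rw [add_comm] at hsum
    refine (klDiv_le_klDiv_add_neg_log _ _ _ (by simpa using hq) hsum).trans ?_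
    rw [ENNReal.toReal_ofReal hq.le, klDiv_gaussianReal _ (by simpa using hv),
      Real.coe_toNNReal _ hv.le, ← ENNReal.ofReal_mul (mul_nonneg hq.le (by linarith)),
      ← ENNReal.ofReal_add (by linarith) (mul_nonneg (mul_nonneg hq.le (by linarith)) (sq_nonneg x))]
    -- An input that is not erased has q x² > 1, so the quadratic bound has slack proportional to q
    -- x² - 1.
    have hx2 : γ / q < γ * x ^ 2 := by
      have := lt_sq_of_sqrt_lt hx
      rwa [sq_abs, mul_pow, sq_sqrt hγ.le] at this
    have hx3 : 0 ≤ q * x ^ 2 - 1 := by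
      rw [div_lt_iff₀ hq] at hx2
      nlinarith
    have hxq : (√γ * x) ^ 2 = γ * x ^ 2 := by rw [mul_pow, sq_sqrt hγ.le]
    have hpos : 0 ≤ 1 / 2 * log (1 + γ / q) + (1 + (√γ * x) ^ 2) / (2 * (1 + γ / q)) - 1 / 2 := by
      rw [hxq]
      have : 1 / 2 ≤ (1 + γ * x ^ 2) / (2 * (1 + γ / q)) := by
        rw [div_le_div_iff₀ (by norm_num) (by positivity)]
        linarith
      linarith
    rw [← ENNReal.ofReal_add (by linarith) hpos]
    refine ENNReal.ofReal_le_ofReal ?_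
    have key : (1 + (√γ * x) ^ 2) / (2 * (1 + γ / q)) - 1 / 2 =
        1 / 2 * (γ / (1 + γ / q)) * ((q * x ^ 2 - 1) / q) := by
      rw [hxq]; field_simp; ring
    have h5 : 1 / 2 * (γ / (1 + γ / q)) * ((q * x ^ 2 - 1) / q) ≤
        1 / 2 * (q * log (1 + γ / q)) * ((q * x ^ 2 - 1) / q) := by
      gcongr
    have h6 : 1 / 2 * (q * log (1 + γ / q)) * ((q * x ^ 2 - 1) / q) =
        1 / 2 * log (1 + γ / q) * (q * x ^ 2 - 1) := by field_simp
    -- The remaining slack is (q x² - 1)(log (1 - q) - log q), nonnegative because q ≤ 1/2.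
    nlinarith [mul_nonneg hx3 (sub_nonneg.2 hlog)]

/-- The rate subtracted from `t` in `diagObjective`. -/
noncomputable def erasureRate (γ q : ℝ) : ℝ := binEntropy q + q / 2 * log (1 + γ / q)

lemma erasureRate_nonneg {γ q : ℝ} (hγ : 0 < γ) (hq : 0 < q) (hq2 : q ≤ 1 / 2) :
    0 ≤ erasureRate γ q :=
  add_nonneg (binEntropy_nonneg hq.le (by linarith))
    (mul_nonneg (by linarith) (log_nonneg (by linarith [div_pos hγ hq])))

/-- The strong data processing bound for an input of unit power. -/
theorem mutualInfo_awgnOutput_le {α : Type*} [MeasurableSpace α] {γ q t : ℝ} (hγ : 0 < γ)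
    (hq : 0 < q) (hq2 : q ≤ 1 / 2) (ht : 0 ≤ t) (ρ : Measure (α × ℝ)) [IsProbabilityMeasure ρ]
    (hX : ∫⁻ p, ENNReal.ofReal (p.2 ^ 2) ∂ρ ≤ 1) (hI : mutualInfo ρ ≤ ENNReal.ofReal t) :
    mutualInfo (awgnOutput γ ρ) ≤
      ENNReal.ofReal (2 * gaussianQ √(γ / q) * erasureRate γ q +
        (1 - 2 * gaussianQ √(γ / q)) * t) := by
  set a := √(γ / q) with ha_def
  have ha : 0 < a := sqrt_pos.2 (div_pos hγ hq)
  have h0 : 0 < 2 * gaussianQ a := mul_pos two_pos (gaussianQ_pos a)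
  have h1 : 0 < 1 - 2 * gaussianQ a := sub_pos.2 (two_mul_gaussianQ_lt_one ha)
  have hq1 : 0 < 1 - q := by linarith
  have := isProbabilityMeasure_infGaussian a ha.le
  have := isMarkovKernel_erasureKernel γ a ha.le
  have := isMarkovKernel_residualKernel γ a ha
  have hlog : log q ≤ log (1 - q) := log_le_log hq (by linarith)
  have hlog0 : log (1 - q) ≤ 0 := log_nonpos hq1.le (by linarith)
  have hlogv0 : 0 ≤ log (1 + γ / q) := log_nonneg (by linarith [div_pos hγ hq])
  set R := ENNReal.ofReal (1 - q) • infGaussian a +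
    ENNReal.ofReal q • gaussianReal 0 (1 + γ / q).toNNReal with hR_def
  have hR : IsProbabilityMeasure R := ⟨by
    simp only [hR_def, Measure.add_apply, Measure.smul_apply, measure_univ, smul_eq_mul, mul_one]
    rw [← ENNReal.ofReal_add hq1.le hq.le]; simp⟩
  have hle (x : ℝ) := klDiv_erasureKernel_le hγ hq hq2 x
  have hac (x : ℝ) : erasureKernel γ a x ≪ R :=
    (klDiv_ne_top_iff.1 (ne_top_of_le_ne_top (by finiteness) (hle x))).1
  rw [awgnOutput_eq_channelOutput]
  refine (mutualInfo_channelOutput_le_of_mixture _ _ _ (ofReal_two_mul_gaussianQ_ne_zero a)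
    (by simpa using h1) (by rw [← ENNReal.ofReal_add h0.le h1.le]; simp)
    (awgnKernel_eq_mixture γ a ha) ρ R hac).trans ?_
  have hint : ∫⁻ p, klDiv (erasureKernel γ a p.2) R ∂ρ ≤ ENNReal.ofReal (erasureRate γ q) := by
    calc ∫⁻ p, klDiv (erasureKernel γ a p.2) R ∂ρ
      _ ≤ ∫⁻ p, (ENNReal.ofReal (-log (1 - q)) +
        ENNReal.ofReal (q * (-log q + log (1 - q) + 1 / 2 * log (1 + γ / q))) *
          ENNReal.ofReal (p.2 ^ 2)) ∂ρ := lintegral_mono fun p ↦ hle p.2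
      _ ≤ ENNReal.ofReal (-log (1 - q)) +
        ENNReal.ofReal (q * (-log q + log (1 - q) + 1 / 2 * log (1 + γ / q))) * 1 := by
        rw [lintegral_add_left measurable_const, lintegral_const_mul _ (by fun_prop)]
        simp only [lintegral_const, measure_univ, mul_one]
        gcongr
        simpa using mul_le_mul_right hX _
      _ = ENNReal.ofReal (erasureRate γ q) := by
        -- At second moment 1 the affine bound equals the erasure rate: the logarithms of q and 1 -
        -- q combine into the binary entropy.
        rw [mul_one, ← ENNReal.ofReal_add (by linarith) (mul_nonneg hq.le (by linarith)),
          erasureRate, binEntropy, log_inv, log_inv]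
        ring_nf
  rw [ENNReal.ofReal_add (mul_nonneg h0.le (erasureRate_nonneg hγ hq hq2)) (mul_nonneg h1.le ht),
    ENNReal.ofReal_mul h0.le, ENNReal.ofReal_mul h1.le]
  gcongr

theorem FI_le_ofReal (t γ : ℝ) : FI.{u} t γ ≤ ENNReal.ofReal t := by
  refine sSup_le ?_
  rintro i ⟨α, _, ρ, hρ, -, hI, rfl⟩
  rw [awgnOutput_eq_channelOutput]
  exact (mutualInfo_channelOutput_le _ ρ).trans hI

theorem FI_le {γ q t : ℝ} (hγ : 0 < γ) (hq : 0 < q) (hq2 : q ≤ 1 / 2) (ht : 0 ≤ t) :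
    FI.{u} t γ ≤ ENNReal.ofReal (2 * gaussianQ √(γ / q) * erasureRate γ q +
        (1 - 2 * gaussianQ √(γ / q)) * t) := by
  refine sSup_le ?_
  rintro i ⟨α, _, ρ, hρ, hX, hI, rfl⟩
  exact mutualInfo_awgnOutput_le hγ hq hq2 ht ρ hX hI

theorem diagObjective_le_gapDiag {γ q t : ℝ} (hγ : 0 < γ) (ht : 0 ≤ t)
    (hq : q ∈ Set.Icc (0 : ℝ) (1 / 2)) : diagObjective t γ q ≤ gapDiag.{u} t γ := by
  rw [gapDiag, diagObjective]
  split_ifs with h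
  -- At q = 0 the claim is only that the gap is nonnegative, which is plain data processing.
  · exact sub_nonneg.2 (ENNReal.toReal_le_of_le_ofReal ht (FI_le_ofReal t γ))
  · have hq0 : 0 < q := lt_of_le_of_ne hq.1 (Ne.symm h)
    have h1 := two_mul_gaussianQ_lt_one (sqrt_pos.2 (div_pos hγ hq0))
    have h2 := ENNReal.toReal_le_of_le_ofReal (add_nonneg
      (mul_nonneg (mul_pos two_pos (gaussianQ_pos _)).le (erasureRate_nonneg hγ hq0 hq.2))
      (mul_nonneg (sub_nonneg.2 h1.le) ht)) (FI_le.{u} hγ hq0 hq.2 ht)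
    rw [erasureRate] at h2
    linarith

lemma tendsto_gaussianQ_atTop : Filter.Tendsto gaussianQ Filter.atTop (nhds 0) := by
  rw [funext gaussianQ_eq_sub]
  have := intervalIntegral_tendsto_integral_Ioi 0
    (integrable_gaussianPDFReal 0 1).integrableOn Filter.tendsto_id
  rw [← gaussianQ_eq] at this
  simpa using this.const_sub (gaussianQ 0)

open Filter Topology

/-- Writing x log(1 + γ/x) = x log(x + γ) - x log x removes the singularity, since x log x is
continuous at 0. -/
lemma tendsto_erasureRate {γ : ℝ} (hγ : 0 < γ) : Tendsto (erasureRate γ) (𝓝[>] 0) (𝓝 0) := by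
  have h1 : ContinuousAt
      (fun x : ℝ ↦ binEntropy x + 1 / 2 * (x * log (x + γ) - x * log x)) 0 := by
    have h2 : ContinuousAt (fun x : ℝ ↦ log (x + γ)) 0 :=
      (continuousAt_id.add continuousAt_const).log (by simpa using hγ.ne')
    exact binEntropy_continuous.continuousAt.add
      (((continuousAt_id.mul h2).sub continuous_mul_log.continuousAt).const_mul (1 / 2))
  have h3 : Tendsto _ (𝓝[>] (0 : ℝ)) _ := h1.tendsto.mono_left nhdsWithin_le_nhds
  simp only [binEntropy_zero, zero_mul, sub_zero, mul_zero, add_zero] at h3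
  refine h3.congr' ?_
  filter_upwards [self_mem_nhdsWithin] with x hx
  have hx : 0 < x := hx
  rw [erasureRate, show 1 + γ / x = (x + γ) / x by field_simp,
    log_div (by positivity) hx.ne']
  ring

lemma continuousOn_diagObjective {γ : ℝ} (hγ : 0 < γ) (t : ℝ) :
    ContinuousOn (diagObjective t γ) (Set.Icc 0 (1 / 2)) := by
  intro x hx
  rcases hx.1.eq_or_lt with rfl | hx0
  · refine ContinuousWithinAt.mono ?_ Set.Icc_subset_Ici_self
    rw [← continuousWithinAt_Ioi_iff_Ici, ContinuousWithinAt]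
    have h1 : Tendsto (fun x : ℝ ↦ gaussianQ √(γ / x)) (𝓝[>] 0) (𝓝 0) := by
      refine tendsto_gaussianQ_atTop.comp (tendsto_sqrt_atTop.comp ?_)
      exact (tendsto_inv_nhdsGT_zero.const_mul_atTop hγ).congr fun x ↦ (div_eq_mul_inv γ x).symm
    have h2 := (h1.const_mul 2).mul ((tendsto_erasureRate hγ).const_sub t)
    rw [mul_zero, zero_mul] at h2
    rw [diagObjective, if_pos rfl]
    refine h2.congr' ?_
    filter_upwards [self_mem_nhdsWithin] with x hx
    rw [diagObjective, if_neg (ne_of_gt hx), erasureRate, sub_add_eq_sub_sub]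
  · refine ContinuousAt.continuousWithinAt ?_
    have hd : ContinuousAt (fun y ↦ γ / y) x := continuousAt_const.div continuousAt_id hx0.ne'
    have hne : 1 + γ / x ≠ 0 := by positivity
    have h1 : ContinuousAt (fun y ↦ 2 * gaussianQ √(γ / y)) x :=
      (continuous_gaussianQ.continuousAt.comp hd.sqrt).const_mul 2
    have h2 : ContinuousAt (fun y ↦ t - binEntropy y - y / 2 * log (1 + γ / y)) x :=
      (continuousAt_const.sub binEntropy_continuous.continuousAt).sub
        ((continuousAt_id.div_const 2).mul ((continuousAt_const.add hd).log hne))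
    refine (h1.mul h2).congr ?_
    filter_upwards [eventually_ne_nhds hx0.ne'] with y hy
    rw [diagObjective, if_neg hy, Pi.mul_apply]

lemma exists_diagObjective_pos {γ t : ℝ} (hγ : 0 < γ) (ht : 0 < t) :
    ∃ x ∈ Set.Icc (0 : ℝ) (1 / 2), 0 < diagObjective t γ x := by
  obtain ⟨x, hx1, hx2, hx0⟩ := ((tendsto_erasureRate hγ).eventually_lt_const ht |>.and
    ((eventually_le_nhds (by norm_num : (0 : ℝ) < 1 / 2)).filter_mono nhdsWithin_le_nhds |>.and
      self_mem_nhdsWithin)).exists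
  have hx0 : 0 < x := hx0
  refine ⟨x, ⟨hx0.le, hx2⟩, ?_⟩
  rw [diagObjective, if_neg hx0.ne', sub_sub]
  exact mul_pos (mul_pos two_pos (gaussianQ_pos _)) (sub_pos.2 hx1)

end GaussianSDPI

theorem mainTheorem1 (γ : ℝ) (hγ : 0 < γ) (t : ℝ) (ht : 0 ≤ t) :
    GaussianSDPI.FI.{u} t γ ≠ ⊤ ∧
    (∃ m : ℝ, IsGreatest (GaussianSDPI.diagObjective t γ '' Set.Icc 0 (1 / 2)) m ∧
      m ≤ GaussianSDPI.gapDiag.{u} t γ) ∧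
    (0 < t → GaussianSDPI.FI.{u} t γ < ENNReal.ofReal t) := by
  have htop : GaussianSDPI.FI.{u} t γ ≠ ⊤ :=
    ne_top_of_le_ne_top ENNReal.ofReal_ne_top (GaussianSDPI.FI_le_ofReal t γ)
  refine ⟨htop, ?_, fun ht0 ↦ ?_⟩
  · obtain ⟨m, hm⟩ := (isCompact_Icc.image_of_continuousOn
      (GaussianSDPI.continuousOn_diagObjective hγ t)).exists_isGreatest
      ((Set.nonempty_Icc.2 (by norm_num)).image _)
    obtain ⟨q, hq, rfl⟩ := hm.1
    exact ⟨_, hm, GaussianSDPI.diagObjective_le_gapDiag hγ ht hq⟩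
  · obtain ⟨x, hx, hpos⟩ := GaussianSDPI.exists_diagObjective_pos hγ ht0
    have h := hpos.trans_le (GaussianSDPI.diagObjective_le_gapDiag.{u} hγ ht hx)
    rw [ENNReal.lt_ofReal_iff_toReal_lt htop]
    exact sub_pos.1 h
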